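/- Let $\Lambda$ be a finite lattice, i.e. a finite connected graph with $N=|\Lambda|\ge 1$ sites, and let $\mathcal H=\bigotimes_{x\in\Lambda}\mathfrak h_x$ with $\mathfrak h_x=\mathfrak h=\mathbb C^d$. Fix a subspace $\mathfrak h^s\subseteq\mathfrak h$ of dimension $d_s$, a basis $\hat H^1,\dots,\hat H^{d_s-1}$ (Hermitian, traceless, commuting, vanishing on $(\mathfrak h^s)^\perp$) of a Cartan subalgebra of $\mathfrak{su}(\mathfrak h^s)$, and an orthonormal basis of $\mathfrak h^s$ of weight states $|\vec m\rangle$, $\hat H^i|\vec m\rangle=m^i|\vec m\rangle$. Let $\mathrm{Sym}^N(\mathfrak h^s)$ be the space of vectors of $\bigotimes_{x\in\Lambda}\mathfrak h^s$ that are invariant under all permutations of the sites; it is spanned by the totally symmetric weight states $$|\psi^\Lambda_{\vec m}\rangle\propto\sum_{\sigma\in\mathfrak S_N}\bigotimes_{x\in\Lambda}|\vec m_{\sigma(x)}\rangle_x,\qquad \sum_{x\in\Lambda}\vec m_x=\vec m .$$ Let $\hat H=\sum_{X\subseteq\Lambda}\hat h_X$ be a local operator on $\mathcal H$: each $\hat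 h_X$ acts non-trivially only on the sites of $X$, $\hat h_X=0$ unless $X$ is connected, and the interaction is not all-to-all, i.e. if $N\ge2$, there are two distinct sites that are not both contained in any $X$ with $\hat h_X\neq0$ (for example, all these $X$ have diameter smaller than that of $\Lambda$). Suppose that every $|\psi^\Lambda_{\vec m}\rangle$ is an eigenvector of $\hat H$. Then $$\hat H=\sum_{x\in\Lambda}\hat h^{(1)}_{[x]}\hat P_x+\sum_{\langle x,y\rangle}\hat h^{(2)}_{[xy]}\hat P_{xy}+\sum_{x\in\Lambda}\sum_{i=1}^{d_s-1}g_i\hat H^i_x+c\,\hat 1,$$ where $\langle x,y\rangle$ runs over the edges of $\Lambda$, $\hat h^{(1)}_{[x]}$ and $\hat h^{(2)}_{[xy]}$ are operators on $\mathcal H$ (not necessarily local), $\hat P_x$ and $\hat P_{xy}$ are orthogonal projectors that act non-trivially only on the site $x$ and on the pair $\{x,y\}$, respectively, and annihilate $\mathrm{Sym}^N(\mathfrak h^s)$, $\hat H^i_x$ is $\hat H^i$ acting on site $x$, and $g_i,c\in\mathbb C$. If $\hat H$ is Hermitian, then the $g_i$ and $c$ are real. -/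

import Mathlib

namespace ScarStates

/-- Pure states of one site, `𝔥 = ℂ^d` with its standard inner product. -/
abbrev Site (d : ℕ) : Type := EuclideanSpace ℂ (Fin d)

/-- The many-body Hilbert space `⨂_{x ∈ Λ} ℂ^d`, in its orthonormal product basis: a vector is
given by its amplitudes on the configurations `s : Λ → Fin d`. -/
abbrev ManyBody (Λ : Type) [Fintype Λ] (d : ℕ) : Type := EuclideanSpace ℂ (Λ → Fin d)

/-- Operators on the many-body space, as matrices in the product basis. -/
abbrev Op (Λ : Type) (d : ℕ) : Type := Matrix (Λ → Fin d) (Λ → Fin d) ℂ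

/-- The product vector `⨂_x v_x`. -/
noncomputable def prodState {Λ : Type} [Fintype Λ] {d : ℕ} (v : Λ → Site d) : ManyBody Λ d :=
  WithLp.toLp 2 (fun s => ∏ x, v x (s x))

/-- Permutation of the sites; on product vectors, `⨂_x v_x ↦ ⨂_x v_{σ x}`. -/
noncomputable def permState {Λ : Type} [Fintype Λ] {d : ℕ} (σ : Equiv.Perm Λ) (ψ : ManyBody Λ d) :
    ManyBody Λ d :=
  WithLp.toLp 2 (fun s => ψ (fun x => s (σ.symm x)))

/-- The operator `B ⊗ 1` that acts as `B` on the sites of `X` and trivially on all others. -/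
def localOp {Λ : Type} [Fintype Λ] [DecidableEq Λ] {d : ℕ} (X : Finset Λ)
    (B : Matrix (X → Fin d) (X → Fin d) ℂ) : Op Λ d :=
  fun s t => if ∀ y, y ∉ X → s y = t y then B (fun x => s x) (fun x => t x) else 0

/-- `A` acts non-trivially only on the sites of `X`. -/
def SupportedOn {Λ : Type} [Fintype Λ] [DecidableEq Λ] {d : ℕ} (X : Finset Λ) (A : Op Λ d) :
    Prop :=
  ∃ B : Matrix (X → Fin d) (X → Fin d) ℂ, A = localOp X B

/-- The one-site operator `M` acting on site `x`. -/
def siteOp {Λ : Type} [Fintype Λ] [DecidableEq Λ] {d : ℕ} (x : Λ)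
    (M : Matrix (Fin d) (Fin d) ℂ) : Op Λ d :=
  fun s t => if ∀ y, y ≠ x → s y = t y then M (s x) (t x) else 0

/-- A `k`-dimensional target space `𝔥ˢ ⊆ ℂ^d` with a Cartan subalgebra of `𝔰𝔲(𝔥ˢ)`: a basis of
`k - 1` traceless commuting Hermitian generators, which act within `𝔥ˢ` (they vanish on its
orthogonal complement), and an orthonormal basis of `𝔥ˢ` of simultaneous eigenvectors
(the weight states `|m⟩`) with their weight vectors. -/
structure CartanData (d k : ℕ) where
  /-- the weight states of `𝔥ˢ` -/
  vec : Fin k → Site d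
  orthonormal_vec : Orthonormal ℂ vec
  /-- the Cartan generators -/
  gen : Fin (k - 1) → Matrix (Fin d) (Fin d) ℂ
  /-- the weight vectors -/
  weight : Fin k → Fin (k - 1) → ℝ
  gen_vec : ∀ i a, (gen i).toEuclideanLin (vec a) = (weight a i : ℂ) • vec a
  gen_orthogonal : ∀ i, ∀ v ∈ (Submodule.span ℂ (Set.range vec))ᗮ, (gen i).toEuclideanLin v = 0
  trace_gen : ∀ i, (gen i).trace = 0
  linearIndependent_gen : LinearIndependent ℂ gen

/-- The target space `𝔥ˢ`. -/
def CartanData.target {d k : ℕ} (C : CartanData d k) : Submodule ℂ (Site d) :=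
  Submodule.span ℂ (Set.range C.vec)

/-- The subspace `⨂_x 𝔥ˢ` of the many-body space. -/
def tensorPower (Λ : Type) [Fintype Λ] {d : ℕ} (W : Submodule ℂ (Site d)) :
    Submodule ℂ (ManyBody Λ d) :=
  Submodule.span ℂ {ψ | ∃ v : Λ → Site d, (∀ x, v x ∈ W) ∧ ψ = prodState v}

/-- `ψ ∈ Sym^N(W)`: the totally symmetric vectors of `⨂_x W`. -/
def MemSymPower {Λ : Type} [Fintype Λ] {d : ℕ} (W : Submodule ℂ (Site d)) (ψ : ManyBody Λ d) :
    Prop :=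
  ψ ∈ tensorPower Λ W ∧ ∀ σ : Equiv.Perm Λ, permState σ ψ = ψ

/-- The totally symmetric weight state obtained by symmetrizing the product of the weight states
`vec (a x)`. It depends only on the total weight `∑ x, weight (a x)`; the normalization constant,
irrelevant for being an eigenvector, is omitted. -/
noncomputable def weightState {Λ : Type} [Fintype Λ] [DecidableEq Λ] {d k : ℕ}
    (C : CartanData d k) (a : Λ → Fin k) : ManyBody Λ d :=
  ∑ σ : Equiv.Perm Λ, permState σ (prodState fun x => C.vec (a x))

/-- The interaction terms `h_X` couple every pair of distinct sites directly. -/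
def AllToAll {Λ : Type} {d : ℕ} (h : Finset Λ → Op Λ d) : Prop :=
  Nontrivial Λ ∧ ∀ x y : Λ, x ≠ y → ∃ X, h X ≠ 0 ∧ x ∈ X ∧ y ∈ X

/-- The family `h_X`, `X ⊆ Λ`, is a local interaction on the lattice `G`: every `h_X` acts only
on `X`, only connected regions occur, and the interaction is not all-to-all, that is, some pair of
sites is contained in no region that occurs. (The last condition holds for instance if the
regions that occur have smaller diameter than the lattice.) -/
structure IsLocalInteraction {Λ : Type} [Fintype Λ] [DecidableEq Λ] {d : ℕ} (G : SimpleGraph Λ)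
    (h : Finset Λ → Op Λ d) : Prop where
  supported : ∀ X, SupportedOn X (h X)
  connected : ∀ X, h X ≠ 0 → (G.induce (X : Set Λ)).Connected
  not_allToAll : ¬ AllToAll h

/-- `P` is an orthogonal projector acting only on the sites of `X` that annihilates `Sym^N(W)`. -/
structure IsLocalAnnihilator {Λ : Type} [Fintype Λ] [DecidableEq Λ] {d : ℕ}
    (W : Submodule ℂ (Site d)) (X : Finset Λ) (P : Op Λ d) : Prop where
  isStarProjection : IsStarProjection P
  supported : SupportedOn X P
  annihilates : ∀ ψ : ManyBody Λ d, MemSymPower W ψ → P.toEuclideanLin ψ = 0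

end ScarStates

/-! The eigenvalues determine the Cartan part; a kernel comparison then supplies the projector part.

Regard the eigenvalue `E a` as a function of the configuration `a` of weight states. Comparing the
amplitude of the product state `a` on both sides of the eigenvalue equation gives `E a = ∑ b,
⟨a|H|b⟩` over the distinct rearrangements `b` of `a` (`eigenvalue_eq_sum_matElt`). Since some pair
`x`, `y` is never coupled, `H = A + B` with `A` trivial at `x` and `B` trivial at `y`. The sum for
an operator trivial at `x` does not depend on `a x` (`IsTrivialAt.sum_orbit_update`), so the mixed
second difference of `E` in `x`, `y` vanishes. As `E` is symmetric, this holds for all pairs, and `E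
a` is a constant plus a sum of one-site terms. The weights together with the constant function span
all functions on the weight states, so some `∑ g_i H^i + c` has the same eigenvalues
(`CartanData.exists_affine`).

The difference of `H` and this operator annihilates every symmetric weight state. The projectors off
the target space at the sites and onto antisymmetric states along the edges have as common kernel
the span of these states, because edge transpositions of a connected graph generate all
permutations. A sum of orthogonal projectors has the intersection of their kernels as kernel, so the
difference factors through this sum on the right. -/

namespace ScarStates

open Matrix

/-! ### Symmetrized product states and the eigenvalue formula. -/

section Amplitudes

variable {Λ : Type} [Fintype Λ] {d k : ℕ}

/-- The amplitudes of the product of the weight states `vec (a x)`. -/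
noncomputable def basisVec (C : CartanData d k) (a : Λ → Fin k) : (Λ → Fin d) → ℂ :=
  fun s => ∏ x, C.vec (a x) (s x)

theorem CartanData.sum_star_vec_mul_vec (C : CartanData d k) (i j : Fin k) :
    ∑ l, star (C.vec i l) * C.vec j l = if i = j then 1 else 0 := by
  have h := orthonormal_iff_ite.mp C.orthonormal_vec i j
  rw [← h]
  simp [PiLp.inner_apply, mul_comm]

theorem permState_prodState (σ : Equiv.Perm Λ) (v : Λ → Site d) :
    permState σ (prodState v) = prodState (v ∘ σ) := by
  ext s
  simp only [permState, prodState, Function.comp]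
  rw [← Equiv.prod_comp σ]
  simp

variable [DecidableEq Λ]

theorem basisVec_orthonormal (C : CartanData d k) (a b : Λ → Fin k) :
    star (basisVec C a) ⬝ᵥ basisVec C b = if a = b then 1 else 0 := by
  have h : ∀ s : Λ → Fin d, star (basisVec C a) s * basisVec C b s
      = ∏ x, (star (C.vec (a x) (s x)) * C.vec (b x) (s x)) := by
    intro s
    simp [basisVec, Finset.prod_mul_distrib]
  simp only [dotProduct, h]
  rw [← Fintype.piFinset_univ,
    ← Finset.prod_univ_sum (fun _ => Finset.univ)
      (fun x l => star (C.vec (a x) l) * C.vec (b x) l)]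
  simp only [C.sum_star_vec_mul_vec, Finset.prod_ite_zero, funext_iff]
  simp

theorem ofLp_weightState (C : CartanData d k) (a : Λ → Fin k) :
    (weightState C a).ofLp = ∑ σ : Equiv.Perm Λ, basisVec C (a ∘ σ) := by
  simp only [weightState, permState_prodState, WithLp.ofLp_sum]
  rfl

theorem weightState_comp (C : CartanData d k) (a : Λ → Fin k) (τ : Equiv.Perm Λ) :
    weightState C (a ∘ τ) = weightState C a := by
  apply WithLp.ofLp_injective
  rw [ofLp_weightState, ofLp_weightState]
  exact Fintype.sum_equiv (Equiv.mulLeft τ) _ _ fun σ => rfl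

/-- The permutations `σ` with `a ∘ σ = b`. -/
def transporters (a b : Λ → Fin k) : Finset (Equiv.Perm Λ) :=
  Finset.univ.filter fun σ => a ∘ σ = b

/-- The fibres of `σ ↦ a ∘ σ` are cosets of the stabilizer of `a`. -/
theorem card_transporters (a : Λ → Fin k) (τ : Equiv.Perm Λ) :
    (transporters a (a ∘ τ)).card = (transporters a a).card := by
  refine Finset.card_equiv (Equiv.mulRight τ⁻¹) fun σ => ?_
  simp only [transporters, Finset.mem_filter, Finset.mem_univ, true_and, Equiv.coe_mulRight]
  constructor
  · intro h
    funext x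
    simpa using congrFun h (τ⁻¹ x)
  · intro h
    funext x
    simpa using congrFun h (τ x)

open Classical in
/-- The rearrangements of the configuration `a`. -/
noncomputable def orbitFinset (a : Λ → Fin k) : Finset (Λ → Fin k) :=
  Finset.univ.filter fun b => ∃ σ : Equiv.Perm Λ, b = a ∘ σ

theorem mem_orbitFinset {a b : Λ → Fin k} :
    b ∈ orbitFinset a ↔ ∃ σ : Equiv.Perm Λ, b = a ∘ σ := by
  simp [orbitFinset]

theorem sum_comp_perm {M : Type*} [AddCommMonoid M] (a : Λ → Fin k) (f : (Λ → Fin k) → M) :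
    ∑ σ : Equiv.Perm Λ, f (a ∘ σ) = (transporters a a).card • ∑ b ∈ orbitFinset a, f b := by
  rw [← Finset.sum_fiberwise_of_maps_to (t := orbitFinset a) (g := fun σ : Equiv.Perm Λ => a ∘ σ)
    (fun σ _ => mem_orbitFinset.2 ⟨σ, rfl⟩), Finset.smul_sum]
  refine Finset.sum_congr rfl fun b hb => ?_
  obtain ⟨τ, rfl⟩ := mem_orbitFinset.1 hb
  rw [← card_transporters a τ, ← Finset.sum_const]
  refine Finset.sum_congr rfl fun σ hσ => ?_
  rw [(Finset.mem_filter.1 hσ).2]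

theorem card_transporters_self_ne_zero (a : Λ → Fin k) : (transporters a a).card ≠ 0 :=
  Finset.card_ne_zero.2 ⟨1, by simp [transporters]⟩

/-- Matrix elements of an operator between products of weight states. -/
noncomputable def matElt (C : CartanData d k) (A : Op Λ d) (a b : Λ → Fin k) : ℂ :=
  star (basisVec C a) ⬝ᵥ A *ᵥ basisVec C b

theorem matElt_add (C : CartanData d k) (A B : Op Λ d) (a b : Λ → Fin k) :
    matElt C (A + B) a b = matElt C A a b + matElt C B a b := by
  simp [matElt, add_mulVec, dotProduct_add]

/-- Pairing the eigenvalue equation with the product state `a` isolates `E`: the states of the orbit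
are orthonormal, and both sides carry the order of the stabilizer of `a` as a factor, which cancels.
-/
theorem eigenvalue_eq_sum_matElt (C : CartanData d k) (H : Op Λ d) (a : Λ → Fin k) (E : ℂ)
    (hE : H.toEuclideanLin (weightState C a) = E • weightState C a) :
    E = ∑ b ∈ orbitFinset a, matElt C H a b := by
  have h := congrArg (fun ψ => star (basisVec C a) ⬝ᵥ WithLp.ofLp ψ) hE
  simp only [ofLp_toLpLin, toLin'_apply, WithLp.ofLp_smul, ofLp_weightState, sum_comp_perm] at h
  rw [mulVec_smul, dotProduct_smul, smul_comm, dotProduct_smul] at h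
  have h2 := smul_right_injective ℂ (card_transporters_self_ne_zero a) h
  rw [dotProduct_smul, dotProduct_sum, mulVec_sum, dotProduct_sum] at h2
  simp only [basisVec_orthonormal, Finset.sum_ite_eq, if_pos
    (mem_orbitFinset.2 ⟨1, rfl⟩ : a ∈ orbitFinset a), smul_eq_mul, mul_one] at h2
  exact h2.symm

theorem weightState_ne_zero (C : CartanData d k) (a : Λ → Fin k) : weightState C a ≠ 0 := by
  intro h0
  have h := congrArg (fun ψ => star (basisVec C a) ⬝ᵥ WithLp.ofLp ψ) h0
  simp only [ofLp_weightState, sum_comp_perm, WithLp.ofLp_zero, dotProduct_zero] at h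
  rw [dotProduct_smul, dotProduct_sum] at h
  simp only [basisVec_orthonormal, Finset.sum_ite_eq, if_pos
    (mem_orbitFinset.2 ⟨1, rfl⟩ : a ∈ orbitFinset a)] at h
  exact card_transporters_self_ne_zero a (by simpa using h)

end Amplitudes

/-! ### Operators trivial at a site. -/

section Locality

variable {Λ : Type} {d k : ℕ}

/-- `A` acts as the identity on the site `x`, that is, `A = A' ⊗ 1_x`. -/
def IsTrivialAt (x : Λ) (A : Op Λ d) : Prop :=
  ∃ A' : Matrix ({y // y ≠ x} → Fin d) ({y // y ≠ x} → Fin d) ℂ,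
    ∀ s t, A s t = if s x = t x then A' (fun y => s y) (fun y => t y) else 0

theorem IsTrivialAt.zero (x : Λ) : IsTrivialAt x (0 : Op Λ d) :=
  ⟨0, fun s t => by simp⟩

theorem IsTrivialAt.add {x : Λ} {A B : Op Λ d} (hA : IsTrivialAt x A) (hB : IsTrivialAt x B) :
    IsTrivialAt x (A + B) := by
  obtain ⟨A', hA'⟩ := hA
  obtain ⟨B', hB'⟩ := hB
  refine ⟨A' + B', fun s t => ?_⟩
  rw [Matrix.add_apply, hA', hB']
  split_ifs <;> simp

theorem IsTrivialAt.sum {ι : Type*} {x : Λ} (S : Finset ι) (A : ι → Op Λ d)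
    (hA : ∀ i ∈ S, IsTrivialAt x (A i)) : IsTrivialAt x (∑ i ∈ S, A i) :=
  Finset.sum_induction A _ (fun _ _ => IsTrivialAt.add) (IsTrivialAt.zero x) hA

variable [Fintype Λ] [DecidableEq Λ]

theorem SupportedOn.isTrivialAt {X : Finset Λ} {A : Op Λ d} (hA : SupportedOn X A) {x : Λ}
    (hx : x ∉ X) : IsTrivialAt x A := by
  obtain ⟨B, rfl⟩ := hA
  have hne : ∀ z : X, (z : Λ) ≠ x := fun z hz => hx (hz ▸ z.2)
  refine ⟨fun s t => if ∀ y, y.1 ∉ X → s y = t y then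
    B (fun z => s ⟨z, hne z⟩) (fun z => t ⟨z, hne z⟩) else 0, fun s t => ?_⟩
  simp only [localOp]
  rw [← ite_and]
  refine if_congr ⟨fun h => ⟨h x hx, fun y hy => h y hy⟩, fun h y hy => ?_⟩ rfl rfl
  by_cases hyx : y = x
  · rw [hyx]; exact h.1
  · exact h.2 ⟨y, hyx⟩ hy

theorem exists_add_isTrivialAt [Nontrivial Λ] {G : SimpleGraph Λ} {h : Finset Λ → Op Λ d}
    (hloc : IsLocalInteraction G h) :
    ∃ (x y : Λ) (A B : Op Λ d), x ≠ y ∧ IsTrivialAt x A ∧ IsTrivialAt y B ∧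
      ∑ X : Finset Λ, h X = A + B := by
  have h0 := hloc.not_allToAll
  simp only [AllToAll, not_and, not_forall, not_exists] at h0
  obtain ⟨x, y, hxy, hX⟩ := h0 inferInstance
  -- The pair `x`, `y` lies in no region that occurs: regions avoiding `x` go into `A`, and those
  -- containing `x` avoid `y` or have zero term.
  refine ⟨x, y, ∑ X with x ∉ X, h X, ∑ X with ¬ x ∉ X, h X, hxy, ?_, ?_, ?_⟩
  · exact IsTrivialAt.sum _ _ fun X hX =>
      (hloc.supported X).isTrivialAt (Finset.mem_filter.1 hX).2
  · refine IsTrivialAt.sum _ _ fun X hx => ?_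
    by_cases h0 : h X = 0
    · rw [h0]; exact IsTrivialAt.zero y
    · exact (hloc.supported X).isTrivialAt
        (hX X h0 (not_not.1 (Finset.mem_filter.1 hx).2))
  · exact (Finset.sum_filter_add_sum_filter_not _ _ _).symm

/-- Sums over configurations, with the site `x` split off. -/
theorem sum_eq_sum_split {n : ℕ} {M : Type*} [AddCommMonoid M] (x : Λ) (f : (Λ → Fin n) → M) :
    ∑ s, f s = ∑ u : {y // y ≠ x} → Fin n, ∑ l,
      f ((Equiv.funSplitAt x (Fin n)).symm (l, u)) := by
  rw [← (Equiv.funSplitAt x (Fin n)).symm.sum_comp, Fintype.sum_prod_type, Finset.sum_comm]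

theorem basisVec_split (C : CartanData d k) (x : Λ) (a : Λ → Fin k) (l : Fin d)
    (u : {y // y ≠ x} → Fin d) :
    basisVec C a ((Equiv.funSplitAt x (Fin d)).symm (l, u))
      = C.vec (a x) l * basisVec C (fun y : {y // y ≠ x} => a y) u := by
  rw [basisVec, Fintype.prod_eq_mul_prod_subtype_ne _ x, basisVec]
  congr 1
  · simp [Equiv.funSplitAt, Equiv.piSplitAt]
  · refine Finset.prod_congr rfl fun y _ => ?_
    simp [Equiv.funSplitAt, Equiv.piSplitAt, y.2]

/-- The site `x` contributes the factor `⟨vec (a x)|vec (b x)⟩`, a Kronecker delta. -/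
theorem IsTrivialAt.matElt (C : CartanData d k) {x : Λ} {A : Op Λ d} (hA : IsTrivialAt x A) :
    ∃ M : ({y // y ≠ x} → Fin k) → ({y // y ≠ x} → Fin k) → ℂ,
      ∀ a b, matElt C A a b = if a x = b x then M (fun y => a y) (fun y => b y) else 0 := by
  obtain ⟨A', hA'⟩ := hA
  refine ⟨fun a b => star (basisVec C a) ⬝ᵥ A' *ᵥ basisVec C b, fun a b => ?_⟩
  have hA2 : ∀ (l m : Fin d) (u v : {y // y ≠ x} → Fin d),
      A ((Equiv.funSplitAt x (Fin d)).symm (l, u)) ((Equiv.funSplitAt x (Fin d)).symm (m, v))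
        = if l = m then A' u v else 0 := by
    intro l m u v
    rw [hA']
    have hw : ∀ (n : Fin d) (w : {y // y ≠ x} → Fin d),
        (fun y : {y // y ≠ x} => if y.1 = x then n else w y) = w := by
      intro n w
      funext y
      simp [y.2]
    simp [Equiv.funSplitAt, Equiv.piSplitAt, hw]
  simp only [ScarStates.matElt, dotProduct, mulVec]
  rw [sum_eq_sum_split x]
  have : ∀ u : {y // y ≠ x} → Fin d,
      (∑ l, star (basisVec C a) ((Equiv.funSplitAt x (Fin d)).symm (l, u)) *
        ∑ t, A ((Equiv.funSplitAt x (Fin d)).symm (l, u)) t * basisVec C b t)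
      = (∑ l, star (C.vec (a x) l) * C.vec (b x) l) *
        (star (basisVec C fun y : {y // y ≠ x} => a y) u *
          ∑ v, A' u v * basisVec C (fun y : {y // y ≠ x} => b y) v) := by
    intro u
    rw [Finset.sum_mul]
    refine Finset.sum_congr rfl fun l _ => ?_
    rw [sum_eq_sum_split x]
    simp only [hA2, basisVec_split, ite_mul, zero_mul, Finset.sum_ite_eq, Finset.mem_univ, if_true,
      Pi.star_apply, star_mul']
    rw [mul_assoc, mul_assoc]
    congr 1
    rw [Finset.mul_sum, Finset.mul_sum, Finset.mul_sum]
    refine Finset.sum_congr rfl fun v _ => ?_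
    ring
  rw [Finset.sum_congr rfl fun u _ => this u, ← Finset.mul_sum, C.sum_star_vec_mul_vec]
  split_ifs <;> simp

theorem update_mem_orbitFinset {x : Λ} {a b : Λ → Fin k} (hb : b ∈ orbitFinset a)
    (hx : a x = b x) (i : Fin k) :
    Function.update b x i ∈ orbitFinset (Function.update a x i) := by
  obtain ⟨σ, rfl⟩ := mem_orbitFinset.1 hb
  -- The transposition makes the permutation fix `x`; it still carries `a` to `b` because `a x = a
  -- (σ x)`.
  refine mem_orbitFinset.2 ⟨Equiv.swap x (σ x) * σ, ?_⟩
  funext y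
  by_cases hy : y = x
  · subst hy; simp
  · have h1 : σ y ≠ σ x := fun h => hy (σ.injective h)
    have h2 : Equiv.swap x (σ x) (σ y) ≠ x := by
      intro h
      rw [Equiv.swap_apply_eq_iff, Equiv.swap_apply_left] at h
      exact h1 h
    simp only [Function.comp, Equiv.Perm.mul_apply, Function.update_of_ne hy,
      Function.update_of_ne h2]
    by_cases h3 : σ y = x
    · rw [h3, Equiv.swap_apply_left]; exact hx
    · rw [Equiv.swap_apply_of_ne_of_ne h3 h1]

/-- Only rearrangements with `b x = a x` contribute. Changing the common value at `x` in both
configurations is a bijection between such rearrangements and preserves the matrix elements. -/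
theorem IsTrivialAt.sum_orbit_update (C : CartanData d k) {x : Λ} {A : Op Λ d}
    (hA : IsTrivialAt x A) (a : Λ → Fin k) (i : Fin k) :
    ∑ b ∈ orbitFinset (Function.update a x i), ScarStates.matElt C A (Function.update a x i) b
      = ∑ b ∈ orbitFinset a, ScarStates.matElt C A a b := by
  obtain ⟨M, hM⟩ := hA.matElt C
  simp only [hM]
  rw [← Finset.sum_filter, ← Finset.sum_filter]
  symm
  have hr : ∀ (c : Λ → Fin k) (j : Fin k),
      (fun y : {y // y ≠ x} => Function.update c x j y) = fun y : {y // y ≠ x} => c y := by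
    intro c j; funext y; simp [Function.update_of_ne y.2]
  refine Finset.sum_nbij' (fun b => Function.update b x i) (fun b => Function.update b x (a x))
    ?_ ?_ ?_ ?_ ?_
  · intro b hb
    rw [Finset.mem_filter] at hb ⊢
    exact ⟨update_mem_orbitFinset hb.1 hb.2 i, by simp⟩
  · intro b hb
    rw [Finset.mem_filter] at hb ⊢
    have := update_mem_orbitFinset hb.1 hb.2 (a x)
    rw [Function.update_idem, Function.update_eq_self] at this
    exact ⟨this, by simp⟩
  · intro b hb
    rw [Finset.mem_filter] at hb
    simp [hb.2]
  · intro b hb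
    have := (Finset.mem_filter.1 hb).2
    rw [Function.update_self] at this
    simp [this]
  · intro b hb
    rw [hr, hr]

end Locality

/-! ### One-site and exchange projectors. -/

section Annihilators

variable {Λ : Type} [Fintype Λ] [DecidableEq Λ] {d k : ℕ}

theorem siteOp_mulVec (x : Λ) (K : Matrix (Fin d) (Fin d) ℂ) (f : (Λ → Fin d) → ℂ)
    (s : Λ → Fin d) :
    (siteOp x K *ᵥ f) s = ∑ l, K (s x) l * f (Function.update s x l) := by
  simp only [mulVec, dotProduct, siteOp, ite_mul, zero_mul]
  rw [← Finset.sum_filter]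
  refine Finset.sum_nbij' (fun t => t x) (fun l => Function.update s x l) ?_ ?_ ?_ ?_ ?_
  · simp
  · intro l _
    simp only [Finset.mem_filter, Finset.mem_univ, true_and]
    intro y hy
    rw [Function.update_of_ne hy]
  · intro t ht
    have ht := (Finset.mem_filter.1 ht).2
    funext y
    by_cases hy : y = x
    · subst hy; simp
    · rw [Function.update_of_ne hy, ht y hy]
  · simp
  · intro t ht
    have ht := (Finset.mem_filter.1 ht).2
    congr 2
    funext y
    by_cases hy : y = x
    · subst hy; simp
    · rw [Function.update_of_ne hy, ht y hy]

theorem siteOp_mul (x : Λ) (K L : Matrix (Fin d) (Fin d) ℂ) :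
    siteOp x K * siteOp x L = siteOp x (K * L) := by
  ext s t
  have h := siteOp_mulVec x K (fun u => siteOp x L u t) s
  simp only [mulVec, dotProduct] at h
  rw [mul_apply, h]
  simp only [siteOp, mul_apply, Function.update_self]
  have : ∀ l, (∀ y, y ≠ x → Function.update s x l y = t y) ↔ ∀ y, y ≠ x → s y = t y :=
    fun l => forall₂_congr fun y hy => by rw [Function.update_of_ne hy]
  simp only [this]
  split_ifs <;> simp

theorem conjTranspose_siteOp (x : Λ) (K : Matrix (Fin d) (Fin d) ℂ) :
    (siteOp x K)ᴴ = siteOp x Kᴴ := by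
  ext s t
  simp only [conjTranspose_apply, siteOp]
  have : (∀ y, y ≠ x → t y = s y) ↔ ∀ y, y ≠ x → s y = t y :=
    forall₂_congr fun y _ => eq_comm
  simp only [this]
  split_ifs <;> simp

theorem supportedOn_siteOp (x : Λ) (K : Matrix (Fin d) (Fin d) ℂ) :
    SupportedOn {x} (siteOp x K) := by
  refine ⟨fun s t => K (s ⟨x, Finset.mem_singleton_self x⟩) (t ⟨x, Finset.mem_singleton_self x⟩),
    ?_⟩
  ext s t
  simp [siteOp, localOp]

/-- The amplitudes of a product vector, with a one-site operator applied at `x`. -/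
theorem siteOp_mulVec_prod (x : Λ) (K : Matrix (Fin d) (Fin d) ℂ) (v : Λ → Fin d → ℂ)
    (s : Λ → Fin d) :
    (siteOp x K *ᵥ fun t => ∏ y, v y (t y)) s
      = (K *ᵥ v x) (s x) * ∏ y : {y // y ≠ x}, v y (s y) := by
  rw [siteOp_mulVec, mulVec, dotProduct, Finset.sum_mul]
  refine Finset.sum_congr rfl fun l _ => ?_
  rw [Fintype.prod_eq_mul_prod_subtype_ne _ x, Function.update_self, mul_assoc]
  congr 2
  refine Finset.prod_congr rfl fun y _ => ?_
  rw [Function.update_of_ne y.2]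

theorem siteOp_mulVec_prod_of_eigen (x : Λ) (K : Matrix (Fin d) (Fin d) ℂ) (v : Λ → Fin d → ℂ)
    (e : ℂ) (hv : K *ᵥ v x = e • v x) :
    (siteOp x K *ᵥ fun t => ∏ y, v y (t y)) = e • fun t => ∏ y, v y (t y) := by
  funext s
  rw [siteOp_mulVec_prod, hv, Pi.smul_apply, Pi.smul_apply,
    Fintype.prod_eq_mul_prod_subtype_ne _ x, smul_mul_assoc]

/-- The orthogonal projector of `ℂ^d` onto the target space. -/
noncomputable def CartanData.proj (C : CartanData d k) : Matrix (Fin d) (Fin d) ℂ :=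
  fun l m => ∑ i, C.vec i l * star (C.vec i m)

theorem CartanData.proj_mulVec (C : CartanData d k) (v : Fin d → ℂ) :
    C.proj *ᵥ v = ∑ i, (star (C.vec i).ofLp ⬝ᵥ v) • (C.vec i).ofLp := by
  funext l
  simp only [mulVec, dotProduct, CartanData.proj, Finset.sum_apply, Pi.smul_apply, smul_eq_mul,
    Finset.sum_mul, Pi.star_apply]
  rw [Finset.sum_comm]
  refine Finset.sum_congr rfl fun i _ => Finset.sum_congr rfl fun m _ => ?_
  ring

theorem CartanData.proj_mulVec_vec (C : CartanData d k) (i : Fin k) :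
    C.proj *ᵥ (C.vec i).ofLp = (C.vec i).ofLp := by
  rw [C.proj_mulVec]
  simp only [dotProduct, Pi.star_apply, C.sum_star_vec_mul_vec]
  simp

theorem CartanData.proj_mulVec_of_mem (C : CartanData d k) {v : Site d} (hv : v ∈ C.target) :
    C.proj *ᵥ v.ofLp = v.ofLp := by
  induction hv using Submodule.span_induction with
  | mem v hv => obtain ⟨i, rfl⟩ := hv; exact C.proj_mulVec_vec i
  | zero => simp
  | add v w _ _ hv hw => simp [mulVec_add, hv, hw]
  | smul c v _ hv => simp [mulVec_smul, hv]

theorem CartanData.proj_mul_proj (C : CartanData d k) : C.proj * C.proj = C.proj := by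
  refine Matrix.ext_of_mulVec_single fun l => ?_
  rw [← mulVec_mulVec]
  conv_lhs => rw [C.proj_mulVec (Pi.single l 1)]
  rw [C.proj_mulVec (Pi.single l 1), mulVec_sum]
  simp only [mulVec_smul, C.proj_mulVec_vec]

theorem CartanData.conjTranspose_proj (C : CartanData d k) : C.projᴴ = C.proj := by
  ext l m
  simp [CartanData.proj, conjTranspose_apply, mul_comm]

/-- The projector onto the states with site `x` orthogonal to the target space. -/
noncomputable def siteAnnihilator (C : CartanData d k) (x : Λ) : Op Λ d :=
  siteOp x (1 - C.proj)

theorem siteOp_one (x : Λ) : siteOp x (1 : Matrix (Fin d) (Fin d) ℂ) = 1 := by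
  ext s t
  simp only [siteOp, one_apply]
  rw [← ite_and]
  refine if_congr ⟨fun h => funext fun y => ?_, ?_⟩ rfl rfl
  · by_cases hy : y = x
    · rw [hy]; exact h.2
    · exact h.1 y hy
  · rintro rfl; simp

theorem siteOp_sub (x : Λ) (K L : Matrix (Fin d) (Fin d) ℂ) :
    siteOp x (K - L) = siteOp x K - siteOp x L := by
  ext s t
  simp only [siteOp, Matrix.sub_apply]
  split_ifs <;> simp

theorem isLocalAnnihilator_siteAnnihilator (C : CartanData d k) (x : Λ) :
    IsLocalAnnihilator C.target {x} (siteAnnihilator C x) where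
  isStarProjection := by
    refine ⟨?_, ?_⟩
    · rw [IsIdempotentElem, siteAnnihilator, siteOp_mul]
      congr 1
      rw [sub_mul, mul_sub, mul_sub, C.proj_mul_proj]
      simp
    · rw [IsSelfAdjoint, siteAnnihilator, star_eq_conjTranspose, conjTranspose_siteOp,
        conjTranspose_sub, C.conjTranspose_proj, conjTranspose_one]
  supported := supportedOn_siteOp x _
  annihilates := by
    rintro ψ ⟨hψ, -⟩
    induction hψ using Submodule.span_induction with
    | mem ψ hψ =>
      obtain ⟨v, hv, rfl⟩ := hψ
      apply WithLp.ofLp_injective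
      rw [ofLp_toLpLin, toLin'_apply, siteAnnihilator]
      refine (siteOp_mulVec_prod_of_eigen x _ (fun y => (v y).ofLp) 0 ?_).trans (zero_smul _ _)
      rw [sub_mulVec, one_mulVec, C.proj_mulVec_of_mem (hv x)]
      simp
    | zero => simp
    | add v w _ _ hv hw => rw [map_add, hv, hw, add_zero]
    | smul c v _ hv => rw [map_smul, hv, smul_zero]

/-- The operator that permutes the sites. -/
def permOp (d : ℕ) (σ : Equiv.Perm Λ) : Op Λ d :=
  fun s t => if t = s ∘ σ then 1 else 0

theorem permOp_mulVec (σ : Equiv.Perm Λ) (f : (Λ → Fin d) → ℂ) (s : Λ → Fin d) :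
    (permOp d σ *ᵥ f) s = f (s ∘ σ) := by
  simp [permOp, mulVec, dotProduct]

theorem permOp_swap_mul_self (x y : Λ) :
    permOp d (Equiv.swap x y) * permOp d (Equiv.swap x y) = 1 := by
  refine Matrix.ext_of_mulVec_single fun l => ?_
  rw [← mulVec_mulVec, one_mulVec]
  funext s
  rw [permOp_mulVec, permOp_mulVec]
  congr 1
  funext z
  simp

theorem conjTranspose_permOp_swap (x y : Λ) :
    (permOp d (Equiv.swap x y))ᴴ = permOp d (Equiv.swap x y) := by
  ext s t
  simp only [conjTranspose_apply, permOp]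
  have : s = t ∘ Equiv.swap x y ↔ t = s ∘ Equiv.swap x y := by
    constructor <;> (rintro rfl; funext z; simp)
  simp only [this]
  split_ifs <;> simp

/-- The projector onto the states that are antisymmetric under the exchange of `x` and `y`. -/
noncomputable def exchangeAnnihilator (d : ℕ) (x y : Λ) : Op Λ d :=
  (2⁻¹ : ℂ) • (1 - permOp d (Equiv.swap x y))

theorem exchangeAnnihilator_comm (x y : Λ) :
    exchangeAnnihilator d x y = exchangeAnnihilator d y x := by
  rw [exchangeAnnihilator, exchangeAnnihilator, Equiv.swap_comm]

theorem localOp_one (X : Finset Λ) : localOp X (1 : Matrix (X → Fin d) (X → Fin d) ℂ) = 1 := by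
  ext s t
  simp only [localOp, one_apply]
  rw [← ite_and]
  refine if_congr ⟨fun h => funext fun y => ?_, ?_⟩ rfl rfl
  · by_cases hy : y ∈ X
    · exact congrFun h.2 ⟨y, hy⟩
    · exact h.1 y hy
  · rintro rfl; simp

theorem localOp_permOp_swap (X : Finset Λ) (x y : X) :
    localOp X (permOp d (Equiv.swap x y)) = permOp d (Equiv.swap (x : Λ) y) := by
  ext s t
  simp only [localOp, permOp]
  rw [← ite_and]
  have hin : ∀ z : X, ((Equiv.swap x y z : X) : Λ) = Equiv.swap (x : Λ) y z := by
    intro z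
    simp only [Equiv.swap_apply_def, Subtype.ext_iff]
    split_ifs <;> rfl
  have hout : ∀ z, z ∉ X → Equiv.swap (x : Λ) y z = z := fun z hz =>
    Equiv.swap_apply_of_ne_of_ne (fun h => hz (h ▸ x.2)) (fun h => hz (h ▸ y.2))
  refine if_congr ⟨fun h => funext fun z => ?_, ?_⟩ rfl rfl
  · by_cases hz : z ∈ X
    · have := congrFun h.2 ⟨z, hz⟩
      simpa [hin] using this
    · simp [hout z hz, h.1 z hz]
  · rintro rfl
    refine ⟨fun z hz => by simp [hout z hz], funext fun z => ?_⟩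
    simp [hin]

theorem supportedOn_exchangeAnnihilator (x y : Λ) :
    SupportedOn {x, y} (exchangeAnnihilator d x y) := by
  refine ⟨exchangeAnnihilator d ⟨x, by simp⟩ ⟨y, by simp⟩, ?_⟩
  have h : ∀ (X : Finset Λ) (A B : Matrix (X → Fin d) (X → Fin d) ℂ),
      localOp X ((2⁻¹ : ℂ) • (A - B)) = (2⁻¹ : ℂ) • (localOp X A - localOp X B) := by
    intro X A B
    ext s t
    simp only [localOp, Matrix.smul_apply, Matrix.sub_apply]
    split_ifs <;> simp
  rw [exchangeAnnihilator, exchangeAnnihilator, h, localOp_one, localOp_permOp_swap]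

theorem isLocalAnnihilator_exchangeAnnihilator (W : Submodule ℂ (Site d)) (x y : Λ) :
    IsLocalAnnihilator W {x, y} (exchangeAnnihilator d x y) where
  isStarProjection := by
    refine ⟨?_, ?_⟩
    · rw [IsIdempotentElem, exchangeAnnihilator, smul_mul_smul_comm, sub_mul, mul_sub, mul_sub,
        permOp_swap_mul_self]
      simp only [one_mul, mul_one]
      rw [show (1 : Op Λ d) - permOp d (Equiv.swap x y) - (permOp d (Equiv.swap x y) - 1)
        = (2 : ℂ) • (1 - permOp d (Equiv.swap x y)) by rw [two_smul]; abel, smul_smul]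
      norm_num
    · rw [IsSelfAdjoint, exchangeAnnihilator, star_eq_conjTranspose, conjTranspose_smul,
        conjTranspose_sub, conjTranspose_permOp_swap, conjTranspose_one]
      simp
  supported := supportedOn_exchangeAnnihilator x y
  annihilates := by
    rintro ψ ⟨-, hψ⟩
    apply WithLp.ofLp_injective
    rw [ofLp_toLpLin, toLin'_apply, exchangeAnnihilator, smul_mulVec, sub_mulVec, one_mulVec]
    have : permOp d (Equiv.swap x y) *ᵥ ψ.ofLp = ψ.ofLp := by
      funext s
      rw [permOp_mulVec]
      have h := congrArg (fun φ : ManyBody Λ d => φ.ofLp s) (hψ (Equiv.swap x y))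
      simpa [permState, Function.comp_def] using h
    rw [this]
    simp

/-- The exchange projector of an unordered pair of sites. -/
noncomputable def edgeAnnihilator (d : ℕ) : Sym2 Λ → Op Λ d :=
  Sym2.lift ⟨exchangeAnnihilator d, exchangeAnnihilator_comm⟩

theorem isLocalAnnihilator_edgeAnnihilator (W : Submodule ℂ (Site d)) (e : Sym2 Λ) :
    IsLocalAnnihilator W e.toFinset (edgeAnnihilator d e) := by
  induction e with
  | _ x y =>
    rw [Sym2.toFinset_mk_eq]
    exact isLocalAnnihilator_exchangeAnnihilator W x y

end Annihilators

/-! ### Symmetric functions with vanishing mixed differences. -/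

section Affine

variable {Λ : Type} [DecidableEq Λ] {k : ℕ}

theorem exists_perm_apply_apply {x y x' y' : Λ} (h : x ≠ y) (h' : x' ≠ y') :
    ∃ σ : Equiv.Perm Λ, σ x = x' ∧ σ y = y' := by
  have hu : Equiv.swap x x' y ≠ x' := by
    intro hy
    rw [Equiv.swap_apply_eq_iff, Equiv.swap_apply_right] at hy
    exact h hy.symm
  exact ⟨Equiv.swap (Equiv.swap x x' y) y' * Equiv.swap x x',
    by simp [Equiv.swap_apply_of_ne_of_ne hu.symm h'], by simp⟩

/-- A symmetric function whose mixed second differences vanish for one pair of sites has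
vanishing mixed second differences for all of them. -/
theorem mixed_difference_of_symmetric {E : (Λ → Fin k) → ℂ}
    (hsymm : ∀ a (σ : Equiv.Perm Λ), E (a ∘ σ) = E a) {x y : Λ} (hxy : x ≠ y)
    (hE : ∀ a i j, E (Function.update (Function.update a x i) y j) + E a
      = E (Function.update a x i) + E (Function.update a y j)) {x' y' : Λ} (hxy' : x' ≠ y')
    (a : Λ → Fin k) (i j : Fin k) :
    E (Function.update (Function.update a x' i) y' j) + E a
      = E (Function.update a x' i) + E (Function.update a y' j) := by
  obtain ⟨σ, rfl, rfl⟩ := exists_perm_apply_apply hxy hxy'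
  have h := hE (a ∘ σ) i j
  rw [← Function.update_comp_eq_of_injective _ σ.injective,
    ← Function.update_comp_eq_of_injective _ σ.injective,
    ← Function.update_comp_eq_of_injective _ σ.injective] at h
  simpa only [hsymm] using h

theorem eq_add_sum_of_mixed_difference [Fintype Λ] {E : (Λ → Fin k) → ℂ}
    (hE : ∀ x y, x ≠ y → ∀ a i j, E (Function.update (Function.update a x i) y j) + E a
      = E (Function.update a x i) + E (Function.update a y j)) (a c : Λ → Fin k) :
    E a = E c + ∑ x, (E (Function.update c x (a x)) - E c) := by
  -- The sites are switched from `c` to `a` one at a time; the second claim says that the increment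
  -- at a site not yet switched is independent of the earlier switches.
  have key : ∀ S : Finset Λ,
      E (S.piecewise a c) = E c + ∑ x ∈ S, (E (Function.update c x (a x)) - E c) ∧
      ∀ z ∉ S, ∀ i, E (Function.update (S.piecewise a c) z i)
        = E (S.piecewise a c) + (E (Function.update c z i) - E c) := by
    intro S
    induction S using Finset.induction_on with
    | empty => simp
    | insert x S hx ih =>
      obtain ⟨ih1, ih2⟩ := ih
      refine ⟨?_, fun z hz i => ?_⟩
      · rw [Finset.piecewise_insert, ih2 x hx, ih1, Finset.sum_insert hx]
        ring
      · rw [Finset.mem_insert, not_or] at hz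
        rw [Finset.piecewise_insert]
        have h1 := hE x z (Ne.symm hz.1) (S.piecewise a c) (a x) i
        have h2 := ih2 z hz.2 i
        linear_combination h1 + h2
  simpa using (key Finset.univ).1

end Affine

/-! ### Weights and the matching of the eigenvalues. -/

section Cartan

variable {d k : ℕ}

theorem CartanData.sub_proj_mem_orthogonal (C : CartanData d k) (v : Fin d → ℂ) :
    WithLp.toLp 2 (v - C.proj *ᵥ v) ∈ (Submodule.span ℂ (Set.range C.vec))ᗮ := by
  rw [Submodule.mem_orthogonal]
  intro u hu
  induction hu using Submodule.span_induction with
  | mem u hu =>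
    obtain ⟨j, rfl⟩ := hu
    have h : star (C.vec j).ofLp ⬝ᵥ (v - C.proj *ᵥ v) = 0 := by
      rw [dotProduct_sub, C.proj_mulVec, dotProduct_sum]
      simp only [dotProduct_smul]
      have : ∀ i, star (C.vec j).ofLp ⬝ᵥ (C.vec i).ofLp = if j = i then 1 else 0 :=
        C.sum_star_vec_mul_vec j
      simp [this]
    rw [EuclideanSpace.inner_eq_star_dotProduct, dotProduct_comm]
    exact h
  | zero => simp
  | add u w _ _ hu hw => rw [inner_add_left, hu, hw, add_zero]
  | smul c u _ hu => rw [inner_smul_left, hu, mul_zero]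

theorem CartanData.gen_mulVec_vec (C : CartanData d k) (i : Fin (k - 1)) (j : Fin k) :
    C.gen i *ᵥ (C.vec j).ofLp = (C.weight j i : ℂ) • (C.vec j).ofLp :=
  congrArg WithLp.ofLp (C.gen_vec i j)

/-- Spectral decomposition: the generator kills the component of each basis vector orthogonal to the
target. -/
theorem CartanData.gen_apply (C : CartanData d k) (i : Fin (k - 1)) (l m : Fin d) :
    C.gen i l m = ∑ j, (C.weight j i : ℂ) * (C.vec j l * star (C.vec j m)) := by
  have h := congrArg WithLp.ofLp
    (C.gen_orthogonal i _ (C.sub_proj_mem_orthogonal (Pi.single m 1)))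
  rw [ofLp_toLpLin, toLin'_apply, WithLp.ofLp_zero, mulVec_sub, sub_eq_zero, C.proj_mulVec,
    mulVec_sum] at h
  have h2 := congrFun h l
  simp only [mulVec_single_one, mulVec_smul, C.gen_mulVec_vec, dotProduct_single_one,
    Finset.sum_apply, Pi.smul_apply, smul_eq_mul, Pi.star_apply] at h2
  rw [show C.gen i l m = (C.gen i).col m l from rfl, h2]
  exact Finset.sum_congr rfl fun j _ => by ring

theorem CartanData.sum_weight (C : CartanData d k) (i : Fin (k - 1)) :
    ∑ j, (C.weight j i : ℂ) = 0 := by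
  have h := C.trace_gen i
  simp only [trace, diag_apply, C.gen_apply] at h
  rw [Finset.sum_comm] at h
  rw [← h]
  refine Finset.sum_congr rfl fun j _ => ?_
  rw [← Finset.mul_sum]
  have := C.sum_star_vec_mul_vec j j
  rw [if_pos rfl] at this
  simp only [mul_comm (C.vec j _), this, mul_one]

/-- The diagonal elements, on the weight states, of `∑ i, g i • gen i + c • 1`. -/
noncomputable def CartanData.diagonal (C : CartanData d k) :
    ((Fin (k - 1) → ℂ) × ℂ) →ₗ[ℂ] (Fin k → ℂ) where
  toFun p := fun j => ∑ i, p.1 i * C.weight j i + p.2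
  map_add' p q := by
    funext j
    simp only [Prod.fst_add, Prod.snd_add, Pi.add_apply, add_mul, Finset.sum_add_distrib]
    ring
  map_smul' r p := by
    funext j
    simp only [Prod.smul_fst, Prod.smul_snd, Pi.smul_apply, smul_eq_mul, RingHom.id_apply,
      mul_add, Finset.mul_sum, mul_assoc]

theorem CartanData.diagonal_injective (C : CartanData d k) (hk : 0 < k) :
    Function.Injective C.diagonal := by
  rw [← LinearMap.ker_eq_bot, LinearMap.ker_eq_bot']
  rintro ⟨g, c⟩ h
  have hj : ∀ j, ∑ i, g i * C.weight j i + c = 0 := fun j => congrFun h j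
  -- Summation over all weight states removes the traceless generators and leaves `k * c = 0`.
  have hc : c = 0 := by
    have hs := Finset.sum_eq_zero (s := Finset.univ) fun j _ => hj j
    rw [Finset.sum_add_distrib, Finset.sum_comm] at hs
    simp only [← Finset.mul_sum, C.sum_weight, mul_zero, Finset.sum_const_zero, zero_add,
      Finset.sum_const, Finset.card_univ, Fintype.card_fin, nsmul_eq_mul, mul_eq_zero,
      Nat.cast_eq_zero] at hs
    exact hs.resolve_left hk.ne'
  subst hc
  have hg : ∑ i, g i • C.gen i = 0 := by
    ext l m
    simp only [Matrix.sum_apply, Matrix.smul_apply, C.gen_apply, smul_eq_mul, Finset.mul_sum,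
      Matrix.zero_apply]
    rw [Finset.sum_comm]
    refine Finset.sum_eq_zero fun j _ => ?_
    simp only [← mul_assoc, ← Finset.sum_mul]
    have := hj j
    rw [add_zero] at this
    simp [this]
  have := Fintype.linearIndependent_iff.1 C.linearIndependent_gen g hg
  rw [Prod.mk_eq_zero]
  exact ⟨funext this, rfl⟩

/-- Injectivity suffices by dimension count, `(k - 1) + 1 = k`; positivity of `k` matters because
the subtraction is truncated. -/
theorem CartanData.diagonal_surjective (C : CartanData d k) (hk : 0 < k) :
    Function.Surjective C.diagonal := by
  refine (LinearMap.injective_iff_surjective_of_finrank_eq_finrank ?_).1 (C.diagonal_injective hk)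
  simp
  omega

variable {Λ : Type} [Fintype Λ] [DecidableEq Λ]

theorem CartanData.exists_affine [Nonempty Λ] (C : CartanData d k) {E : (Λ → Fin k) → ℂ}
    (hsymm : ∀ a (σ : Equiv.Perm Λ), E (a ∘ σ) = E a)
    (hE : ∀ x y, x ≠ y → ∀ a i j, E (Function.update (Function.update a x i) y j) + E a
      = E (Function.update a x i) + E (Function.update a y j)) :
    ∃ (g : Fin (k - 1) → ℂ) (c : ℂ), (∀ a, E a = ∑ x, ∑ i, g i * C.weight (a x) i + c) ∧
      ((∀ a, (E a).im = 0) → (∀ i, (g i).im = 0) ∧ c.im = 0) := by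
  -- For `k = 0` there are no configurations, since `Λ` is nonempty.
  rcases Nat.eq_zero_or_pos k with rfl | hk
  · exact ⟨0, 0, fun a => (a (Classical.arbitrary Λ)).elim0, by simp⟩
  set x₀ : Λ := Classical.arbitrary Λ
  let o : Λ → Fin k := fun _ => ⟨0, hk⟩
  have hφ : ∀ x i, E (Function.update o x i) = E (Function.update o x₀ i) := by
    intro x i
    rw [← hsymm _ (Equiv.swap x₀ x)]
    congr 1
    have := Function.update_comp_eq_of_injective o (Equiv.swap x₀ x).injective x₀ i
    rw [Equiv.swap_apply_left] at this
    rw [this]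
    rfl
  obtain ⟨⟨g, c₁⟩, hg⟩ := C.diagonal_surjective hk fun j => E (Function.update o x₀ j) - E o
  have hg' : ∀ j, ∑ i, g i * C.weight j i + c₁ = E (Function.update o x₀ j) - E o :=
    fun j => congrFun hg j
  -- Each site contributes `c₁` besides its weight term, so the constant is `E o` plus `c₁` times
  -- the number of sites.
  have hEa : ∀ a, E a = ∑ x, ∑ i, g i * C.weight (a x) i + (E o + Fintype.card Λ * c₁) := by
    intro a
    rw [eq_add_sum_of_mixed_difference hE a o]
    simp only [hφ, ← hg', Finset.sum_add_distrib, Finset.sum_const, Finset.card_univ,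
      nsmul_eq_mul]
    ring
  refine ⟨g, _, hEa, fun him => ?_⟩
  set c := E o + Fintype.card Λ * c₁
  -- Imaginary parts on the constant configurations, with real weights, give a kernel element of
  -- `diagonal`; the cardinality counts the equal one-site terms.
  have h0 : C.diagonal (fun i => (Fintype.card Λ : ℂ) * ((g i).im : ℂ), (c.im : ℂ)) = 0 := by
    funext j
    have h1 := congrArg Complex.im (hEa fun _ => j)
    rw [him] at h1
    simp only [Complex.add_im, Complex.im_sum, Complex.im_mul_ofReal] at h1
    rw [Finset.sum_const, Finset.card_univ, nsmul_eq_mul] at h1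
    have h2 := congrArg (fun r : ℝ => (r : ℂ)) h1
    push_cast at h2
    simp only [CartanData.diagonal, LinearMap.coe_mk, AddHom.coe_mk, Pi.zero_apply]
    rw [h2, Finset.mul_sum]
    simp only [mul_assoc]
  have h3 := C.diagonal_injective hk (h0.trans (map_zero _).symm)
  rw [Prod.mk_eq_zero] at h3
  refine ⟨fun i => ?_, by exact_mod_cast h3.2⟩
  have := congrFun h3.1 i
  simpa using this

end Cartan

/-! ### The common kernel of the projectors. -/

section Kernel

variable {Λ : Type} [Fintype Λ] {d k : ℕ}

theorem basisVec_comp (C : CartanData d k) (a : Λ → Fin k) (σ : Equiv.Perm Λ) (s : Λ → Fin d) :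
    basisVec C a (s ∘ σ) = basisVec C (a ∘ σ.symm) s := by
  simp only [basisVec, Function.comp]
  rw [← Equiv.prod_comp σ (fun x => C.vec (a (σ.symm x)) (s x))]
  simp

variable [DecidableEq Λ]

theorem eq_sum_basisVec_of_annihilated (C : CartanData d k) (f : (Λ → Fin d) → ℂ)
    (hf : ∀ x, siteAnnihilator C x *ᵥ f = 0) :
    ∃ c : (Λ → Fin k) → ℂ, f = ∑ a, c a • basisVec C a := by
  have hx : ∀ x, siteOp x C.proj *ᵥ f = f := by
    intro x
    have h := hf x
    rw [siteAnnihilator, siteOp_sub, siteOp_one, sub_mulVec, one_mulVec, sub_eq_zero] at h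
    exact h.symm
  -- `Q S` applies the target projector at every site of `S`. It fixes `f`, and for `S` the whole
  -- lattice it is the sum of `|a⟩⟨a|` over all configurations.
  let Q : Finset Λ → Op Λ d := fun S s t => ∏ x, (if x ∈ S then C.proj else 1) (s x) (t x)
  have hQ : ∀ S, Q S *ᵥ f = f := by
    intro S
    induction S using Finset.induction_on with
    | empty =>
      have : Q ∅ = 1 := by
        ext s t
        simp only [Q, Finset.notMem_empty, if_false, one_apply, Finset.prod_ite_zero]
        simp [funext_iff]
      rw [this, one_mulVec]
    | insert x S hxS ih =>
      have : Q (insert x S) = siteOp x C.proj * Q S := by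
        ext s t
        have h := siteOp_mulVec_prod x C.proj
          (fun y l => (if y ∈ S then C.proj else 1) l (t y)) s
        simp only [mulVec, dotProduct] at h
        rw [mul_apply, h, if_neg hxS]
        have h1 : ∑ l, C.proj (s x) l * (1 : Matrix (Fin d) (Fin d) ℂ) l (t x)
            = C.proj (s x) (t x) := by
          rw [← mul_apply, mul_one]
        rw [h1]
        change ∏ y, (if y ∈ insert x S then C.proj else 1) (s y) (t y) = _
        rw [Fintype.prod_eq_mul_prod_subtype_ne _ x, if_pos (Finset.mem_insert_self x S)]
        congr 1
        refine Finset.prod_congr rfl fun y _ => ?_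
        simp only [Finset.mem_insert, y.2, false_or]
      rw [this, ← mulVec_mulVec, ih, hx]
  refine ⟨fun a => star (basisVec C a) ⬝ᵥ f, ?_⟩
  conv_lhs => rw [← hQ Finset.univ]
  funext s
  have hQs : ∀ t, Q Finset.univ s t = ∑ a, basisVec C a s * star (basisVec C a t) := by
    intro t
    simp only [Q, Finset.mem_univ, if_true, CartanData.proj, Finset.prod_univ_sum,
      Fintype.piFinset_univ, basisVec, Finset.prod_mul_distrib, star_prod]
  simp only [mulVec, dotProduct, hQs, Finset.sum_mul, Finset.sum_apply, Pi.smul_apply,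
    smul_eq_mul, Pi.star_apply]
  rw [Finset.sum_comm]
  refine Finset.sum_congr rfl fun a _ => Finset.sum_congr rfl fun t _ => ?_
  ring

/-- A vector invariant under the exchanges along the edges of a connected graph is invariant under
all permutations. -/
theorem comp_perm_of_edgeAnnihilator {G : SimpleGraph Λ} (hG : G.Connected)
    (f : (Λ → Fin d) → ℂ) (hf : ∀ e ∈ G.edgeSet, edgeAnnihilator d e *ᵥ f = 0)
    (σ : Equiv.Perm Λ) (s : Λ → Fin d) : f (s ∘ σ) = f s := by
  -- The permutations fixing `f` form a submonoid; edge transpositions lie in it, and walks in the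
  -- graph yield all transpositions.
  let M : Submonoid (Equiv.Perm Λ) :=
    { carrier := {τ | ∀ s, f (s ∘ τ) = f s}
      one_mem' := fun s => rfl
      mul_mem' := fun {τ₁ τ₂} h₁ h₂ s => by
        rw [Equiv.Perm.coe_mul, ← Function.comp_assoc, h₂, h₁] }
  have hedge : ∀ x y, G.Adj x y → Equiv.swap x y ∈ M := by
    intro x y hxy s
    have h := congrFun (hf s(x, y) hxy) s
    simp only [edgeAnnihilator, Sym2.lift_mk, exchangeAnnihilator, smul_mulVec, sub_mulVec,
      one_mulVec, Pi.smul_apply, Pi.sub_apply, permOp_mulVec, Pi.zero_apply, smul_eq_mul,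
      mul_eq_zero, inv_eq_zero, OfNat.ofNat_ne_zero, false_or, sub_eq_zero] at h
    exact h.symm
  have hswap : ∀ x y, Equiv.swap x y ∈ M := by
    intro x y
    obtain ⟨w⟩ := hG.preconnected x y
    induction w with
    | nil => rw [Equiv.swap_self]; exact M.one_mem
    | cons h _ ih => exact SubmonoidClass.swap_mem_trans M (hedge _ _ h) ih
  have hσ : σ ∈ M := by
    induction σ using Equiv.Perm.swap_induction_on with
    | one => exact M.one_mem
    | swap_mul τ x y _ ih => exact M.mul_mem (hswap x y) ih
  exact hσ s

/-- An operator that annihilates the totally symmetric weight states vanishes on every vector that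
the one-site and exchange projectors annihilate. -/
theorem mulVec_eq_zero_of_annihilated {G : SimpleGraph Λ} (hG : G.Connected)
    (C : CartanData d k) (A : Op Λ d) (hA : ∀ a, A *ᵥ (weightState C a).ofLp = 0)
    (f : (Λ → Fin d) → ℂ) (h₁ : ∀ x, siteAnnihilator C x *ᵥ f = 0)
    (h₂ : ∀ e ∈ G.edgeSet, edgeAnnihilator d e *ᵥ f = 0) : A *ᵥ f = 0 := by
  obtain ⟨c, hc⟩ := eq_sum_basisVec_of_annihilated C f h₁
  -- Summing the expansion of the invariant vector `f` over all permutations turns each product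
  -- state into a symmetric weight state.
  have hsum : (Fintype.card (Equiv.Perm Λ) : ℂ) • f = ∑ a, c a • (weightState C a).ofLp := by
    have : ∀ σ : Equiv.Perm Λ, f = ∑ a, c a • basisVec C (a ∘ σ) := by
      intro σ
      funext s
      rw [← comp_perm_of_edgeAnnihilator hG f h₂ σ.symm s]
      conv_lhs => rw [hc]
      simp [basisVec_comp]
    simp only [ofLp_weightState, Finset.smul_sum]
    rw [Finset.sum_comm, Finset.sum_congr rfl fun σ _ => (this σ).symm,
      Finset.sum_const, Finset.card_univ, Nat.cast_smul_eq_nsmul]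
  have h := congrArg (A *ᵥ ·) hsum
  simp only [mulVec_smul, mulVec_sum, hA, smul_zero, Finset.sum_const_zero] at h
  exact (smul_eq_zero.1 h).resolve_left (by simp [Fintype.card_ne_zero])

end Kernel

/-! ### Factorization and kernels of sums of projectors. -/

section LinearAlgebra

variable {n : Type*} [Fintype n]

theorem exists_eq_mul_of_ker_le [DecidableEq n] {K : Type*} [Field K] (A S : Matrix n n K)
    (h : ∀ f, S *ᵥ f = 0 → A *ᵥ f = 0) : ∃ B, A = B * S := by
  -- `A` descends to the quotient by the kernel of `S`, which is the range of `S`; any extension of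
  -- the resulting map to the whole space serves as `B`.
  let φ := ((LinearMap.ker (toLin' S)).liftQ (toLin' A) fun f hf => by
    simpa using h f (by simpa using hf)) ∘ₗ (toLin' S).quotKerEquivRange.symm.toLinearMap
  obtain ⟨ψ, hψ⟩ := φ.exists_extend
  refine ⟨LinearMap.toMatrix' ψ, (toLin' (R := K)).injective (LinearMap.ext fun f => ?_)⟩
  rw [toLin'_mul, toLin'_toMatrix', LinearMap.comp_apply]
  have h1 := LinearMap.congr_fun hψ ⟨toLin' S f, LinearMap.mem_range_self _ f⟩
  rw [LinearMap.comp_apply, Submodule.subtype_apply] at h1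
  rw [h1, LinearMap.comp_apply, LinearEquiv.coe_coe,
    show (⟨toLin' S f, LinearMap.mem_range_self _ f⟩ : LinearMap.range (toLin' S))
      = (toLin' S).quotKerEquivRange (Submodule.Quotient.mk f) from rfl,
    LinearEquiv.symm_apply_apply]
  rfl

-- The expectation value of the sum in `f` equals `∑ ‖P i f‖²`, so every term vanishes.
open scoped ComplexOrder in
theorem mulVec_eq_zero_of_sum_mulVec_eq_zero {ι : Type*} (I : Finset ι) (P : ι → Matrix n n ℂ)
    (hP : ∀ i ∈ I, IsStarProjection (P i)) (f : n → ℂ) (hf : (∑ i ∈ I, P i) *ᵥ f = 0) :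
    ∀ i ∈ I, P i *ᵥ f = 0 := by
  have hq : ∀ i ∈ I, star f ⬝ᵥ P i *ᵥ f = star (P i *ᵥ f) ⬝ᵥ P i *ᵥ f := by
    intro i hi
    rw [star_mulVec, ← dotProduct_mulVec, mulVec_mulVec, ← star_eq_conjTranspose,
      (hP i hi).isSelfAdjoint.star_eq, (hP i hi).isIdempotentElem.eq]
  have h0 : ∑ i ∈ I, star f ⬝ᵥ P i *ᵥ f = 0 := by
    rw [← dotProduct_sum, ← sum_mulVec, hf, dotProduct_zero]
  rw [Finset.sum_congr rfl hq,
    Finset.sum_eq_zero_iff_of_nonneg fun i _ => dotProduct_star_self_nonneg _] at h0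
  exact fun i hi => dotProduct_star_self_eq_zero.1 (h0 i hi)

end LinearAlgebra

end ScarStates

/-! ### The decomposition theorem. -/

open ScarStates in
theorem theorem6p1 {Λ : Type} [Fintype Λ] [DecidableEq Λ] (G : SimpleGraph Λ)
    [DecidableRel G.Adj] (hG : G.Connected) {d k : ℕ} (C : CartanData d k)
    (h : Finset Λ → Op Λ d) (hloc : IsLocalInteraction G h)
    (H : Op Λ d) (hH : H = ∑ X : Finset Λ, h X)
    (heig : ∀ a : Λ → Fin k, ∃ E : ℂ,
      H.toEuclideanLin (weightState C a) = E • weightState C a) :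
    ∃ (h₁ P₁ : Λ → Op Λ d) (h₂ P₂ : Sym2 Λ → Op Λ d) (g : Fin (k - 1) → ℂ) (c : ℂ),
      (∀ x, IsLocalAnnihilator C.target {x} (P₁ x)) ∧
      (∀ e ∈ G.edgeFinset, IsLocalAnnihilator C.target e.toFinset (P₂ e)) ∧
      H = ∑ x, h₁ x * P₁ x + ∑ e ∈ G.edgeFinset, h₂ e * P₂ e
          + ∑ x, siteOp x (∑ i, g i • C.gen i) + c • 1 ∧
      (H.IsHermitian → (∀ i, (g i).im = 0) ∧ c.im = 0) := by
  have : Nonempty Λ := hG.nonempty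
  choose E hE using heig
  have hsymm : ∀ a (σ : Equiv.Perm Λ), E (a ∘ σ) = E a := by
    intro a σ
    have h1 := hE (a ∘ σ)
    rw [weightState_comp, hE a] at h1
    exact (smul_left_injective ℂ (weightState_ne_zero C a) h1).symm
  have hmixed : ∀ x y, x ≠ y → ∀ a i j, E (Function.update (Function.update a x i) y j) + E a
      = E (Function.update a x i) + E (Function.update a y j) := by
    intro x y hxy
    have : Nontrivial Λ := ⟨x, y, hxy⟩
    obtain ⟨x₀, y₀, A, B, hxy₀, hA, hB, hAB⟩ := exists_add_isTrivialAt hloc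
    refine mixed_difference_of_symmetric hsymm hxy₀ (fun a i j => ?_) hxy
    have hsplit : ∀ a, E a = ∑ b ∈ orbitFinset a, matElt C A a b
        + ∑ b ∈ orbitFinset a, matElt C B a b := by
      intro a
      rw [eigenvalue_eq_sum_matElt C H a (E a) (hE a), hH, hAB, ← Finset.sum_add_distrib]
      exact Finset.sum_congr rfl fun b _ => matElt_add C A B a b
    -- The `B` sums do not see the change at `y₀` and the `A` sums do not see the change at `x₀`, so
    -- the two sides agree.
    rw [hsplit (Function.update (Function.update a x₀ i) y₀ j), hsplit a,
      hsplit (Function.update a x₀ i), hsplit (Function.update a y₀ j),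
      hB.sum_orbit_update, hB.sum_orbit_update, hA.sum_orbit_update,
      Function.update_comm hxy₀, hA.sum_orbit_update]
    ring
  obtain ⟨g, c, hEg, hreal⟩ := C.exists_affine hsymm hmixed
  let A : Op Λ d := H - (∑ x, siteOp x (∑ i, g i • C.gen i) + c • 1)
  have hA : ∀ a, A.mulVec (weightState C a).ofLp = 0 := by
    intro a
    have h1 : H.mulVec (weightState C a).ofLp = E a • (weightState C a).ofLp :=
      congrArg WithLp.ofLp (hE a)
    have h2 : ∀ (b : Λ → Fin k) x, (siteOp x (∑ i, g i • C.gen i)).mulVec (basisVec C b)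
        = (∑ i, g i * C.weight (b x) i) • basisVec C b := by
      intro b x
      refine siteOp_mulVec_prod_of_eigen x _ (fun y => (C.vec (b y)).ofLp) _ ?_
      simp only [Matrix.sum_mulVec, Matrix.smul_mulVec, C.gen_mulVec_vec, Finset.sum_smul,
        smul_smul]
    have h3 : (∑ x, siteOp x (∑ i, g i • C.gen i) + c • 1 : Op Λ d).mulVec (weightState C a).ofLp
        = E a • (weightState C a).ofLp := by
      rw [ofLp_weightState, Matrix.mulVec_sum, Finset.smul_sum]
      refine Finset.sum_congr rfl fun σ _ => ?_
      rw [← hsymm a σ, hEg, Matrix.add_mulVec, Matrix.sum_mulVec, Matrix.smul_mulVec,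
        Matrix.one_mulVec, add_smul, Finset.sum_smul]
      simp only [h2]
    rw [Matrix.sub_mulVec, h1, h3, sub_self]
  let I : Finset (Λ ⊕ Sym2 Λ) := Finset.univ.disjSum G.edgeFinset
  let P : Λ ⊕ Sym2 Λ → Op Λ d := Sum.elim (siteAnnihilator C) (edgeAnnihilator d)
  have hP : ∀ i ∈ I, IsStarProjection (P i) := by
    rintro (x | e) -
    · exact (isLocalAnnihilator_siteAnnihilator C x).isStarProjection
    · exact (isLocalAnnihilator_edgeAnnihilator C.target e).isStarProjection
  obtain ⟨B, hB⟩ := exists_eq_mul_of_ker_le A (∑ i ∈ I, P i) fun f hf => by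
    have h0 := mulVec_eq_zero_of_sum_mulVec_eq_zero I P hP f hf
    refine mulVec_eq_zero_of_annihilated hG C A hA f (fun x => h0 (Sum.inl x) (by simp [I]))
      fun e he => h0 (Sum.inr e) (by simpa [I] using he)
  -- The one cofactor `B` serves for all projectors, since the sum of the projectors is what factors
  -- out.
  refine ⟨fun _ => B, siteAnnihilator C, fun _ => B, edgeAnnihilator d, g, c,
    isLocalAnnihilator_siteAnnihilator C, fun e _ => isLocalAnnihilator_edgeAnnihilator _ e, ?_, ?_⟩
  · rw [Finset.sum_disjSum, Matrix.mul_add, Finset.mul_sum, Finset.mul_sum] at hB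
    rw [add_assoc, ← sub_eq_iff_eq_add]
    exact hB
  · intro hHerm
    refine hreal fun a => ?_
    have := (Matrix.isSymmetric_toEuclideanLin_iff.2 hHerm).conj_eigenvalue_eq_self
      (Module.End.hasEigenvalue_of_hasEigenvector
        ⟨Module.End.mem_eigenspace_iff.2 (hE a), weightState_ne_zero C a⟩)
    exact Complex.conj_eq_iff_im.1 this
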